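/- Let $p,q\ge 0$ be integers, $n=p+q$, and let $I_{p,q}=\operatorname{diag}(1,\dots,1,-1,\dots,-1)\in M_n(\mathbb{C})$, with $p$ entries $1$ followed by $q$ entries $-1$. Let $$U(p,q)=\{A\in GL(n,\mathbb{C}) : A^{*}I_{p,q}A=I_{p,q}\}$$ be the indefinite unitary group and let $$\mathfrak{u}_{p,q}=\{X\in M_n(\mathbb{C}) : X^{*}I_{p,q}+I_{p,q}X=0\}$$ be its (real) Lie algebra. Then the matrix exponential $X\mapsto e^{X}=\sum_{k\ge 0}X^{k}/k!$, which maps $\mathfrak{u}_{p,q}$ into $U(p,q)$, is a surjective map $\exp:\mathfrak{u}_{p,q}\to U(p,q)$. -/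

import Mathlib

open scoped Matrix

attribute [local instance 100] LieRing.ofAssociativeRing

/-- The matrix `I_{p,q} = diag(1, …, 1, -1, …, -1)` (`p` entries `1`, then `q` entries `-1`), with
rows and columns indexed by the disjoint union of `Fin p` and `Fin q`. -/
def signatureMatrix (p q : ℕ) : Matrix (Fin p ⊕ Fin q) (Fin p ⊕ Fin q) ℂ :=
  LieAlgebra.Orthogonal.indefiniteDiagonal (Fin p) (Fin q) ℂ

theorem signatureMatrix_mul_self (p q : ℕ) : signatureMatrix p q * signatureMatrix p q = 1 := by
  rw [signatureMatrix, LieAlgebra.Orthogonal.indefiniteDiagonal, Matrix.diagonal_mul_diagonal,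
    ← Matrix.diagonal_one]
  congr 1
  funext i
  rcases i with i | i <;> simp

/-- The indefinite unitary group `U(p,q)`: the subgroup of those `A ∈ GL(p+q, ℂ)` with
`A⋆ I_{p,q} A = I_{p,q}`. -/
def indefiniteUnitaryGroup (p q : ℕ) : Subgroup (GL (Fin p ⊕ Fin q) ℂ) where
  carrier := {A | (A : Matrix (Fin p ⊕ Fin q) (Fin p ⊕ Fin q) ℂ)ᴴ * signatureMatrix p q *
    (A : Matrix (Fin p ⊕ Fin q) (Fin p ⊕ Fin q) ℂ) = signatureMatrix p q}
  one_mem' := by simp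
  mul_mem' := by
    intro A B hA hB
    simp only [Set.mem_ofPred_eq] at hA hB ⊢
    rw [Units.val_mul, Matrix.conjTranspose_mul]
    calc _ = (B : Matrix (Fin p ⊕ Fin q) (Fin p ⊕ Fin q) ℂ)ᴴ *
          ((A : Matrix (Fin p ⊕ Fin q) (Fin p ⊕ Fin q) ℂ)ᴴ * signatureMatrix p q *
            (A : Matrix (Fin p ⊕ Fin q) (Fin p ⊕ Fin q) ℂ)) *
          (B : Matrix (Fin p ⊕ Fin q) (Fin p ⊕ Fin q) ℂ) := by simp only [mul_assoc]
      _ = signatureMatrix p q := by rw [hA, hB]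
  inv_mem' := by
    intro A hA
    simp only [Set.mem_ofPred_eq] at hA ⊢
    have h1 : (A : Matrix (Fin p ⊕ Fin q) (Fin p ⊕ Fin q) ℂ) *
        ((A⁻¹ : GL (Fin p ⊕ Fin q) ℂ) : Matrix (Fin p ⊕ Fin q) (Fin p ⊕ Fin q) ℂ) = 1 :=
      A.mul_inv
    have h2 : ((A⁻¹ : GL (Fin p ⊕ Fin q) ℂ) : Matrix (Fin p ⊕ Fin q) (Fin p ⊕ Fin q) ℂ)ᴴ *
        (A : Matrix (Fin p ⊕ Fin q) (Fin p ⊕ Fin q) ℂ)ᴴ = 1 := by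
      rw [← Matrix.conjTranspose_mul, h1, Matrix.conjTranspose_one]
    conv_lhs => rw [← hA]
    rw [mul_assoc, mul_assoc, h1, mul_one, ← mul_assoc, h2, one_mul]

/-- The real Lie algebra `𝔲_{p,q}`: the complex matrices `X` with `X⋆ I_{p,q} + I_{p,q} X = 0`,
with the commutator bracket. -/
def indefiniteUnitaryLieAlgebra (p q : ℕ) :
    LieSubalgebra ℝ (Matrix (Fin p ⊕ Fin q) (Fin p ⊕ Fin q) ℂ) where
  carrier := {X | Xᴴ * signatureMatrix p q + signatureMatrix p q * X = 0}
  zero_mem' := by simp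
  add_mem' := by
    intro X Y hX hY
    simp only [Set.mem_ofPred_eq] at hX hY ⊢
    rw [Matrix.conjTranspose_add, add_mul, mul_add, add_add_add_comm, hX, hY, add_zero]
  smul_mem' := by
    intro c X hX
    simp only [Set.mem_ofPred_eq] at hX ⊢
    rw [Matrix.conjTranspose_smul, star_trivial, smul_mul_assoc, mul_smul_comm, ← smul_add, hX,
      smul_zero]
  lie_mem' := by
    intro X Y hX hY
    have hX' : Xᴴ * signatureMatrix p q = -(signatureMatrix p q * X) := eq_neg_of_add_eq_zero_left hX
    have hY' : Yᴴ * signatureMatrix p q = -(signatureMatrix p q * Y) := eq_neg_of_add_eq_zero_left hY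
    change (⁅X, Y⁆)ᴴ * signatureMatrix p q + signatureMatrix p q * ⁅X, Y⁆ = 0
    rw [Ring.lie_def, Matrix.conjTranspose_sub, Matrix.conjTranspose_mul, Matrix.conjTranspose_mul,
      sub_mul, mul_assoc, mul_assoc, hX', hY', mul_neg, mul_neg, ← mul_assoc, ← mul_assoc, hX', hY']
    noncomm_ring

/-- The matrix exponential of an element of `𝔲_{p,q}` lies in `U(p,q)`. -/
theorem exp_mem_indefiniteUnitaryGroup (p q : ℕ) (X : indefiniteUnitaryLieAlgebra p q) :
    (Matrix.isUnit_exp (X : Matrix (Fin p ⊕ Fin q) (Fin p ⊕ Fin q) ℂ)).unit ∈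
      indefiniteUnitaryGroup p q := by
  obtain ⟨X, hX⟩ := X
  change (NormedSpace.exp X)ᴴ * signatureMatrix p q * NormedSpace.exp X = signatureMatrix p q
  have hX' : Xᴴ * signatureMatrix p q = signatureMatrix p q * (-X) := by
    rw [mul_neg]; exact eq_neg_of_add_eq_zero_left hX
  let J : (Matrix (Fin p ⊕ Fin q) (Fin p ⊕ Fin q) ℂ)ˣ :=
    ⟨signatureMatrix p q, signatureMatrix p q, signatureMatrix_mul_self p q,
      signatureMatrix_mul_self p q⟩
  have h1 : Xᴴ = (J : Matrix (Fin p ⊕ Fin q) (Fin p ⊕ Fin q) ℂ) * (-X) *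
      ((J⁻¹ : (Matrix (Fin p ⊕ Fin q) (Fin p ⊕ Fin q) ℂ)ˣ) :
        Matrix (Fin p ⊕ Fin q) (Fin p ⊕ Fin q) ℂ) := by
    change Xᴴ = signatureMatrix p q * (-X) * signatureMatrix p q
    rw [← hX', mul_assoc, signatureMatrix_mul_self, mul_one]
  have h2 : NormedSpace.exp (-X) * NormedSpace.exp X = 1 := by
    rw [← Matrix.exp_add_of_commute (-X) X (Commute.neg_left (Commute.refl X)), neg_add_cancel,
      NormedSpace.exp_zero]
  rw [← Matrix.exp_conjTranspose, h1, Matrix.exp_units_conj]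
  change signatureMatrix p q * NormedSpace.exp (-X) * signatureMatrix p q * signatureMatrix p q *
    NormedSpace.exp X = signatureMatrix p q
  rw [mul_assoc (signatureMatrix p q * NormedSpace.exp (-X)), signatureMatrix_mul_self, mul_one,
    mul_assoc, h2, mul_one]

/-- The exponential map `exp : 𝔲_{p,q} → U(p,q)`, `X ↦ ∑ₖ Xᵏ / k!`. -/
noncomputable def indefiniteUnitaryExp (p q : ℕ) (X : indefiniteUnitaryLieAlgebra p q) :
    indefiniteUnitaryGroup p q :=
  ⟨(Matrix.isUnit_exp (X : Matrix (Fin p ⊕ Fin q) (Fin p ⊕ Fin q) ℂ)).unit,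
    exp_mem_indefiniteUnitaryGroup p q X⟩

theorem coe_indefiniteUnitaryExp (p q : ℕ) (X : indefiniteUnitaryLieAlgebra p q) :
    ((indefiniteUnitaryExp p q X : GL (Fin p ⊕ Fin q) ℂ) :
      Matrix (Fin p ⊕ Fin q) (Fin p ⊕ Fin q) ℂ) =
      NormedSpace.exp (X : Matrix (Fin p ⊕ Fin q) (Fin p ⊕ Fin q) ℂ) := rfl

/-! Let `J` be the signature matrix. If `X` is a logarithm of `A ∈ U(p,q)`, so is `J * -Xᴴ * J`, and
`X` lies in the Lie algebra exactly when the two coincide. Take `X` principal (eigenvalues with `-π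
< Im ≤ π`) and commuting with everything that commutes with `A`. The map `μ ↦ -conj μ` fixes
imaginary parts, so the second logarithm is principal too; it commutes with its exponential `A`,
hence with `X`. Two commuting principal logarithms of one matrix are equal
(`eq_of_commute_of_exp_eq`). Existence (`exists_principal_log`) comes from the Jordan–Chevalley
decomposition. -/

namespace Matrix

open Polynomial NormedSpace

variable {n : Type*} [Fintype n] [DecidableEq n]

section ExpSeries

open scoped Matrix.Norms.Operator

theorem exp_mulVec_of_mulVec_eq_smul {M : Matrix n n ℂ} {v : n → ℂ} {μ : ℂ}
    (h : M *ᵥ v = μ • v) : exp M *ᵥ v = Complex.exp μ • v := by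
  have hpow : ∀ k : ℕ, M ^ k *ᵥ v = μ ^ k • v := by
    intro k
    induction k with
    | zero => simp
    | succ k ih => rw [pow_succ, ← mulVec_mulVec, h, mulVec_smul, ih, smul_smul, pow_succ']
  have h1 : HasSum (fun k : ℕ => ((k.factorial : ℂ)⁻¹ • M ^ k) *ᵥ v) (exp M *ᵥ v) :=
    (exp_series_hasSum_exp' (𝕂 := ℂ) M).map
      (AddMonoidHom.mk' (fun B : Matrix n n ℂ => B *ᵥ v) fun _ _ => add_mulVec _ _ _)
      (continuous_id.matrix_mulVec continuous_const)
  have h2 : HasSum (fun k : ℕ => ((k.factorial : ℂ)⁻¹ • μ ^ k) • v) (Complex.exp μ • v) := by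
    rw [Complex.exp_eq_exp_ℂ]
    exact (exp_series_hasSum_exp' (𝕂 := ℂ) μ).smul_const v
  refine h1.unique (h2.congr_fun fun k => ?_)
  rw [smul_mulVec, hpow, smul_assoc]

/-- The second order expansion of the exponential of a nilpotent matrix. -/
theorem exists_exp_eq_of_isNilpotent {M : Matrix n n ℂ} (h : IsNilpotent M) :
    ∃ Q : ℂ[X], exp M = 1 + M + M ^ 2 * aeval M Q := by
  obtain ⟨k, hk⟩ := h
  refine ⟨∑ i ∈ Finset.range k, C ((i + 2).factorial : ℂ)⁻¹ * X ^ i, ?_⟩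
  have h1 : HasSum (fun i : ℕ => (i.factorial : ℂ)⁻¹ • M ^ i)
      (∑ i ∈ Finset.range (k + 2), (i.factorial : ℂ)⁻¹ • M ^ i) := by
    refine hasSum_sum_of_ne_finset_zero fun i hi => ?_
    rw [pow_eq_zero_of_le (by simp at hi; omega) hk, smul_zero]
  refine ((exp_series_hasSum_exp' (𝕂 := ℂ) M).unique h1).trans ?_
  rw [Finset.sum_range_succ', Finset.sum_range_succ', map_sum, Finset.mul_sum]
  have h2 : ∀ i : ℕ, M ^ 2 * aeval M (C ((i + 2).factorial : ℂ)⁻¹ * X ^ i) =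
      ((i + 2).factorial : ℂ)⁻¹ • M ^ (i + 2) := by
    intro i
    rw [map_mul, aeval_C, map_pow, aeval_X, ← Algebra.smul_def, mul_smul_comm, ← pow_add,
      add_comm 2 i]
  simp only [h2]
  simp only [zero_add, pow_zero, pow_one, Nat.factorial_zero, Nat.factorial_one, Nat.cast_one,
    inv_one, one_smul]
  abel

end ExpSeries

/-- A unipotent matrix has a nilpotent logarithm. -/
theorem exists_isNilpotent_exp_eq_one_add {N : Matrix n n ℂ} (h : IsNilpotent N) :
    ∃ Y ∈ Algebra.adjoin ℂ {N}, IsNilpotent Y ∧ exp Y = 1 + N := by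
  suffices ∀ (k : ℕ) (N : Matrix n n ℂ), N ^ (k + 1) = 0 →
      ∃ Y ∈ Algebra.adjoin ℂ {N}, IsNilpotent Y ∧ exp Y = 1 + N by
    obtain ⟨k, hk⟩ := h
    exact this k N (by rw [pow_succ, hk, zero_mul])
  intro k
  induction k with
  | zero =>
    intro N hN
    obtain rfl : N = 0 := by simpa using hN
    exact ⟨0, zero_mem _, IsNilpotent.zero, by simp⟩
  | succ k ih =>
    intro N hN
    -- `N` is a first-order logarithm: the error `R = exp(-N)(1 + N) - 1` is divisible by `N²`, so
    -- its nilpotency order is lower and induction applies.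
    obtain ⟨Q, hQ⟩ := exists_exp_eq_of_isNilpotent (M := -N) (IsNilpotent.neg ⟨_, hN⟩)
    have hNA : N ∈ Algebra.adjoin ℂ {N} := Algebra.self_mem_adjoin_singleton ℂ N
    set G := aeval (-N) Q
    have hGA : G ∈ Algebra.adjoin ℂ {N} :=
      Algebra.adjoin_le (by simp [hNA]) (aeval_mem_adjoin_singleton ℂ (-N))
    have hcomm : Commute N G := Algebra.commute_of_mem_adjoin_self hGA
    set R := N * (-1 + (1 + N) * G) * N with hR
    have hRA : N * (-1 + (1 + N) * G) * N ∈ Algebra.adjoin ℂ {N} :=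
      mul_mem (mul_mem hNA (add_mem (neg_mem (one_mem _)) (mul_mem (add_mem (one_mem _) hNA) hGA)))
        hNA
    have hc1 : Commute N (-1 + (1 + N) * G) :=
      (Commute.neg_right (Commute.one_right N)).add_right
        (((Commute.one_right N).add_right (Commute.refl N)).mul_right hcomm)
    have hR2 : R = N ^ 2 * (-1 + (1 + N) * G) := by
      rw [hR, mul_assoc, ← hc1.eq, ← mul_assoc, sq]
    have hR0 : R ^ (k + 1) = 0 := by
      rw [hR2, (hc1.pow_left 2).mul_pow, ← pow_mul, pow_eq_zero_of_le (by omega) hN, zero_mul]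
    have hexp : exp (-N) * (1 + N) = 1 + R := by
      rw [hQ, hR2, even_two.neg_pow, add_mul _ _ (1 + N), mul_assoc (N ^ 2) G,
        show G * (1 + N) = (1 + N) * G from
          ((Commute.one_right G).add_right hcomm.symm).eq, sq]
      noncomm_ring
    obtain ⟨Y, hYR, hYnil, hY⟩ := ih R hR0
    have hYA : Y ∈ Algebra.adjoin ℂ {N} := Algebra.adjoin_le (by simpa using hRA) hYR
    have hNY : Commute N Y := Algebra.commute_of_mem_adjoin_self hYA
    refine ⟨N + Y, add_mem hNA hYA, hNY.isNilpotent_add ⟨_, hN⟩ hYnil, ?_⟩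
    rw [exp_add_of_commute _ _ hNY, hY, ← hexp, ← mul_assoc,
      ← exp_add_of_commute _ _ (Commute.neg_right (Commute.refl N)), add_neg_cancel,
      NormedSpace.exp_zero, one_mul]

theorem mem_spectrum_iff_exists_mulVec_eq_smul {M : Matrix n n ℂ} {μ : ℂ} :
    μ ∈ spectrum ℂ M ↔ ∃ v ≠ 0, M *ᵥ v = μ • v := by
  rw [← spectrum_toLin', ← Module.End.hasEigenvalue_iff_mem_spectrum]
  constructor
  · intro hμ
    obtain ⟨v, hv⟩ := hμ.exists_hasEigenvector
    exact ⟨v, hv.2, hv.apply_eq_smul⟩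
  · rintro ⟨v, hv0, hv⟩
    exact Module.End.hasEigenvalue_of_hasEigenvector ⟨Module.End.mem_eigenspace_iff.2 hv, hv0⟩

theorem isNilpotent_of_spectrum_subset_zero {M : Matrix n n ℂ} (h : ∀ μ ∈ spectrum ℂ M, μ = 0) :
    IsNilpotent M := by
  have hroots : M.charpoly.roots = Multiset.replicate M.charpoly.roots.card 0 :=
    Multiset.eq_replicate_card.2 fun μ hμ =>
      h μ (mem_spectrum_of_isRoot_charpoly (isRoot_of_mem_roots hμ))
  refine ⟨M.charpoly.roots.card, ?_⟩
  have hX : M.charpoly = X ^ M.charpoly.roots.card := by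
    conv_lhs => rw [(IsAlgClosed.splits M.charpoly).eq_prod_roots_of_monic M.charpoly_monic, hroots]
    simp
  simpa only [map_pow, aeval_X, aeval_self_charpoly] using congrArg (aeval M) hX.symm

/-- Commuting matrices have a joint eigenvector for each eigenvalue of their difference. -/
theorem exists_mem_spectrum_sub_mem_spectrum {X Y : Matrix n n ℂ} (hXY : Commute X Y) {μ : ℂ}
    (hμ : μ ∈ spectrum ℂ (X - Y)) : ∃ a ∈ spectrum ℂ X, a - μ ∈ spectrum ℂ Y := by
  set f : Module.End ℂ (n → ℂ) := toLin' X
  set g : Module.End ℂ (n → ℂ) := toLin' Y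
  have hcomm : Commute (f - g) f :=
    (Commute.refl f).sub_left (hXY.symm.map (toLinAlgEquiv' (R := ℂ) (n := n)))
  rw [← spectrum_toLin', map_sub, ← Module.End.hasEigenvalue_iff_mem_spectrum] at hμ
  have hmaps := Module.End.mapsTo_genEigenspace_of_comm hcomm μ 1
  have : Nontrivial (Module.End.genEigenspace (f - g) μ 1) :=
    Submodule.nontrivial_iff_ne_bot.2 hμ
  obtain ⟨a, ha⟩ := Module.End.exists_eigenvalue (f.restrict hmaps)
  obtain ⟨⟨v, hvE⟩, hv⟩ := ha.exists_hasEigenvector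
  have hv0 : v ≠ 0 := fun h => hv.2 (Subtype.ext h)
  have hfv : f v = a • v := congrArg Subtype.val hv.apply_eq_smul
  have hfgv : (f - g) v = μ • v := Module.End.mem_eigenspace_iff.1 hvE
  have hgv : g v = (a - μ) • v := by
    rw [sub_smul, ← hfv, ← hfgv, LinearMap.sub_apply, sub_sub_cancel]
  exact ⟨a, mem_spectrum_iff_exists_mulVec_eq_smul.2 ⟨v, hv0, hfv⟩,
    mem_spectrum_iff_exists_mulVec_eq_smul.2 ⟨v, hv0, hgv⟩⟩

/-- Commuting logarithms with eigenvalues in the strip `-π < Im ≤ π` coincide. -/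
theorem eq_of_commute_of_exp_eq {X Y : Matrix n n ℂ} (hXY : Commute X Y)
    (hX : ∀ μ ∈ spectrum ℂ X, μ.im ∈ Set.Ioc (-Real.pi) Real.pi)
    (hY : ∀ μ ∈ spectrum ℂ Y, μ.im ∈ Set.Ioc (-Real.pi) Real.pi)
    (hexp : NormedSpace.exp X = NormedSpace.exp Y) : X = Y := by
  have hone : NormedSpace.exp (X - Y) = 1 := by
    rw [sub_eq_add_neg, exp_add_of_commute _ _ hXY.neg_right, hexp,
      ← exp_add_of_commute _ _ (Commute.refl Y).neg_right, add_neg_cancel, NormedSpace.exp_zero]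
  have hnil : IsNilpotent (X - Y) := by
    -- An eigenvalue `μ` of `X - Y` is a difference of two numbers in the strip with equal
    -- exponentials, hence zero.
    refine isNilpotent_of_spectrum_subset_zero fun μ hμ => ?_
    obtain ⟨v, hv0, hv⟩ := mem_spectrum_iff_exists_mulVec_eq_smul.1 hμ
    obtain ⟨a, ha, hb⟩ := exists_mem_spectrum_sub_mem_spectrum hXY hμ
    have h1 := exp_mulVec_of_mulVec_eq_smul hv
    rw [hone, one_mulVec] at h1
    have h2 : Complex.exp a = Complex.exp (a - μ) := by
      have : Complex.exp μ = 1 := by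
        have : (Complex.exp μ - 1) • v = 0 := by rw [sub_smul, ← h1, one_smul, sub_self]
        exact sub_eq_zero.1 ((smul_eq_zero.1 this).resolve_right hv0)
      rw [Complex.exp_sub, this, div_one]
    have h3 := Complex.exp_inj_of_neg_pi_lt_of_le_pi (hX a ha).1 (hX a ha).2 (hY _ hb).1
      (hY _ hb).2 h2
    linear_combination h3
  -- For nilpotent `M`, `exp M - 1` is `M` times a unit.
  obtain ⟨Q, hQ⟩ := exists_exp_eq_of_isNilpotent hnil
  set M := X - Y
  have hc : Commute M (aeval M Q) :=
    Algebra.commute_of_mem_adjoin_self (aeval_mem_adjoin_singleton ℂ M)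
  have hu : IsUnit (1 + M * aeval M Q) :=
    (hc.isNilpotent_mul_right hnil).isUnit_one_add
  have h0 : M * (1 + M * aeval M Q) = 0 := by
    have : 1 + M * (1 + M * aeval M Q) = 1 := by
      rw [mul_add, mul_one, ← mul_assoc, ← sq, ← add_assoc, ← hQ, hone]
    simpa using this
  exact sub_eq_zero.1 ((hu.mul_left_eq_zero).1 h0)

/-- The principal logarithm of a diagonalizable invertible matrix. -/
theorem exists_log_of_isSemisimple {S : Matrix n n ℂ}
    (hS : Module.End.IsSemisimple (toLin' S)) (hu : IsUnit S) : ∃ L ∈ Algebra.adjoin ℂ {S}, NormedSpace.exp L = S ∧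
      ∀ μ ∈ spectrum ℂ L, μ.im ∈ Set.Ioc (-Real.pi) Real.pi := by
  have : Finite (spectrum ℂ S) := Matrix.finite_spectrum S
  -- Interpolating `Complex.log` on the finite spectrum makes the logarithm a polynomial in `S`.
  obtain ⟨p, hp⟩ := (exists_eval_eq_iff (fun μ : spectrum ℂ S => (μ : ℂ))
    (fun μ => Complex.log μ)).2 fun i j h => congrArg Complex.log h
  refine ⟨aeval S p, aeval_mem_adjoin_singleton ℂ S, ?_, ?_⟩
  · refine toLin'.injective ?_
    refine LinearMap.eqLocus_eq_top.1 (top_le_iff.1 ?_)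
    rw [← hS.iSup_eigenspace_eq_top]
    refine iSup_le fun μ v hv => ?_
    rcases eq_or_ne v 0 with rfl | hv0
    · exact zero_mem _
    have hSv : S *ᵥ v = μ • v := Module.End.mem_eigenspace_iff.1 hv
    have hμ : μ ∈ spectrum ℂ S := mem_spectrum_iff_exists_mulVec_eq_smul.2 ⟨v, hv0, hSv⟩
    have hμ0 : μ ≠ 0 := fun h => spectrum.zero_notMem ℂ hu (h ▸ hμ)
    have hpv : aeval S p *ᵥ v = Complex.log μ • v := by
      have h1 := Module.End.aeval_apply_of_hasEigenvector (p := p)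
        (show Module.End.HasEigenvector (toLin' S) μ v from ⟨hv, hv0⟩)
      rw [hp ⟨μ, hμ⟩] at h1
      have h2 : aeval (toLin' S : Module.End ℂ (n → ℂ)) p = toLin' (aeval S p) :=
        aeval_algHom_apply (toLinAlgEquiv' (R := ℂ) (n := n)).toAlgHom S p
      rwa [h2] at h1
    change NormedSpace.exp (aeval S p) *ᵥ v = S *ᵥ v
    rw [exp_mulVec_of_mulVec_eq_smul hpv, Complex.exp_log hμ0, hSv]
  · intro μ hμ
    rcases isEmpty_or_nonempty n with hn | hn
    · exact absurd (isUnit_of_subsingleton _) hμ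
    rw [spectrum.map_polynomial_aeval_of_nonempty S p
      (spectrum.nonempty_of_isAlgClosed_of_finiteDimensional ℂ S)] at hμ
    obtain ⟨a, ha, rfl⟩ := hμ
    simp only [hp ⟨a, ha⟩]
    exact ⟨Complex.neg_pi_lt_log_im a, Complex.log_im_le_pi a⟩

/-- The principal logarithm of an invertible complex matrix. -/
theorem exists_principal_log {A : Matrix n n ℂ} (hA : IsUnit A) :
    ∃ X : Matrix n n ℂ, NormedSpace.exp X = A ∧ (∀ B, Commute B A → Commute B X) ∧
      ∀ μ ∈ spectrum ℂ X, μ.im ∈ Set.Ioc (-Real.pi) Real.pi := by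
  obtain ⟨N', hN', S', hS', hnil, hss, hsum⟩ :=
    Module.End.exists_isNilpotent_isSemisimple (f := toLinAlgEquiv' (R := ℂ) A)
  obtain ⟨N, rfl⟩ := (toLinAlgEquiv' (R := ℂ) (n := n)).surjective N'
  obtain ⟨S, rfl⟩ := (toLinAlgEquiv' (R := ℂ) (n := n)).surjective S'
  have hmem : ∀ {T : Matrix n n ℂ}, toLinAlgEquiv' T ∈ Algebra.adjoin ℂ {toLinAlgEquiv' (R := ℂ) A} →
      ∀ B, Commute B A → Commute B T := by
    intro T hT B hB
    have := Algebra.commute_of_mem_adjoin_singleton_of_commute hT (hB.map toLinAlgEquiv')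
    exact toLinAlgEquiv'.injective (by simpa only [map_mul] using this.eq)
  have hAs : A = N + S := toLinAlgEquiv'.injective (by rw [hsum, map_add])
  have hNn : IsNilpotent N := (IsNilpotent.map_iff toLinAlgEquiv'.injective).1 hnil
  have hAS : Commute A S := hmem hS' A (Commute.refl A)
  have hAN : Commute A N := hmem hN' A (Commute.refl A)
  have hSu : IsUnit S := by
    have := hNn.neg.isUnit_add_left_of_commute hA hAN.symm.neg_left
    rwa [hAs, add_neg_cancel_comm] at this
  obtain ⟨L, hL, hexpL, hspec⟩ := exists_log_of_isSemisimple hss hSu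
  have hLc : ∀ B, Commute B A → Commute B L := fun B hB =>
    Algebra.commute_of_mem_adjoin_singleton_of_commute hL (hmem hS' B hB)
  have hKc : ∀ B, Commute B A → Commute B (NormedSpace.exp (-L) * N) := fun B hB =>
    ((hLc B hB).neg_right.exp_right).mul_right (hmem hN' B hB)
  have hLN : Commute L N := hmem hN' L (hLc A (Commute.refl A)).symm
  have hcN : Commute (NormedSpace.exp (-L)) N := hLN.neg_left.exp_left
  -- Since `exp(-L) = S⁻¹`, this is the logarithm of the unipotent factor in `A = S(1 + S⁻¹N)`.
  obtain ⟨Y, hY, hYn, hexpY⟩ :=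
    exists_isNilpotent_exp_eq_one_add (hcN.isNilpotent_mul_left hNn)
  have hYc : ∀ B, Commute B A → Commute B Y := fun B hB =>
    Algebra.commute_of_mem_adjoin_singleton_of_commute hY (hKc B hB)
  have hLY : Commute L Y := hYc L (hLc A (Commute.refl A)).symm
  refine ⟨L + Y, ?_, fun B hB => (hLc B hB).add_right (hYc B hB), fun μ hμ => hspec μ ?_⟩
  · rw [exp_add_of_commute _ _ hLY, hexpY, mul_add, mul_one, ← mul_assoc,
      ← exp_add_of_commute _ _ (Commute.refl L).neg_right, add_neg_cancel, NormedSpace.exp_zero,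
      one_mul, hexpL, hAs, add_comm]
  -- Adding the commuting nilpotent `Y` to `L` creates no new eigenvalues.
  · rw [spectrum.mem_iff] at hμ ⊢
    contrapose! hμ
    have := hYn.neg.isUnit_add_left_of_commute hμ
      (((Algebra.commute_algebraMap_right μ Y).sub_right hLY.symm).neg_left)
    rwa [← sub_eq_add_neg, sub_sub] at this

end Matrix

theorem mainTheorem8 (p q : ℕ) : Function.Surjective (indefiniteUnitaryExp p q) := by
  rintro ⟨A, hA⟩
  set J := signatureMatrix p q
  have hJJ : J * J = 1 := signatureMatrix_mul_self p q
  obtain ⟨X, hXA, hXc, hX⟩ := Matrix.exists_principal_log A.isUnit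
  replace hA : (A : Matrix (Fin p ⊕ Fin q) (Fin p ⊕ Fin q) ℂ)ᴴ * J * A = J := hA
  let U : (Matrix (Fin p ⊕ Fin q) (Fin p ⊕ Fin q) ℂ)ˣ := ⟨J, J, hJJ, hJJ⟩
  have hexp : NormedSpace.exp (J * -Xᴴ * J) = A := by
    refine (Matrix.exp_units_conj U (-Xᴴ)).trans ?_
    change J * NormedSpace.exp (-Xᴴ) * J = A
    rw [Matrix.exp_neg, Matrix.exp_conjTranspose, hXA]
    have h1 : ((A : Matrix (Fin p ⊕ Fin q) (Fin p ⊕ Fin q) ℂ)ᴴ)⁻¹ = J * A * J := by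
      refine Matrix.inv_eq_right_inv ?_
      rw [← mul_assoc, ← mul_assoc, hA, hJJ]
    rw [h1, ← mul_assoc, ← mul_assoc, hJJ, one_mul, mul_assoc, hJJ, mul_one]
  have hspec : ∀ μ ∈ spectrum ℂ (J * -Xᴴ * J), μ.im ∈ Set.Ioc (-Real.pi) Real.pi := by
    intro μ hμ
    have h1 : spectrum ℂ (J * -Xᴴ * J) = spectrum ℂ (-Xᴴ) :=
      spectrum.units_conjugate (a := -Xᴴ) (u := U)
    rw [h1, ← spectrum.neg_eq, Set.mem_neg, ← Matrix.star_eq_conjTranspose, spectrum.map_star,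
      Set.mem_star] at hμ
    simpa using hX _ hμ
  have hcomm : Commute X (J * -Xᴴ * J) :=
    (hXc _ (hexp ▸ (Commute.refl _).exp_right)).symm
  have hXeq := Matrix.eq_of_commute_of_exp_eq hcomm hX hspec (hXA.trans hexp.symm)
  refine ⟨⟨X, ?_⟩, Subtype.ext (Units.ext hXA)⟩
  change Xᴴ * J + J * X = 0
  have hJX : J * X = -(Xᴴ * J) := by
    conv_lhs => rw [hXeq]
    rw [← mul_assoc, ← mul_assoc, hJJ, one_mul, neg_mul]
  rw [hJX, add_neg_cancel]
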